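/- Let $\mathbb{K}=\mathbb{R}$ or $\mathbb{C}$ and let $N$ be a connected (in particular non-empty) smooth real manifold of dimension $n\ge 0$ (Hausdorff, second countable, without boundary). Then there exists a Hilbert space $H$ over $\mathbb{K}$ whose elements are continuous functions $f:\mathbb{R}^n\to\mathbb{K}$ (with the pointwise linear operations), such that every evaluation functional (delta function) $\delta_a: f\mapsto f(a)$, $a\in\mathbb{R}^n$, is bounded on $H$, and such that the set $M_n=\{\delta_a : a\in\mathbb{R}^n\}$ of all delta functions in the dual space $H^{*}$ (with its norm topology, regarded as a real Banach space) is a smooth embedded $n$-dimensional submanifold of $H^{*}$ that is diffeomorphic to $N$. That is, $M_n$ with the subspace topology carries a $C^\infty$ structure for which the inclusion $M_n\to H^{*}$ is a $C^\infty$ embedding, and $M_n$ with this structure is $C^\infty$-diffeomorphic to $N$. -/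

import Mathlib

open Manifold
open scoped Manifold ContDiff

/-- The delta function at `a`: the evaluation functional `f ↦ f a`, as an element of the dual
of a Hilbert space `H` of scalar functions on `X` on which evaluations are bounded. -/
noncomputable def deltaFunctional {𝕜 : Type*} [RCLike 𝕜] {X : Type*} (H : Type*)
    [NormedAddCommGroup H] [InnerProductSpace 𝕜 H] [RKHS 𝕜 H X 𝕜] (a : X) :
    StrongDual 𝕜 H :=
  (ContinuousLinearMap.proj (R := 𝕜) (φ := fun _ : X => 𝕜) a).comp (RKHS.coeCLM 𝕜)

/-- A delta function evaluates functions: `δ_a f = f a`. -/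
theorem deltaFunctional_apply {𝕜 : Type*} [RCLike 𝕜] {X : Type*} {H : Type*}
    [NormedAddCommGroup H] [InnerProductSpace 𝕜 H] [RKHS 𝕜 H X 𝕜] (a : X) (f : H) :
    deltaFunctional H a f = f a := rfl

/-- The set of all delta functions, inside the dual of `H` with its norm topology. -/
def deltaSet {𝕜 : Type*} [RCLike 𝕜] {X : Type*} (H : Type*)
    [NormedAddCommGroup H] [InnerProductSpace 𝕜 H] [RKHS 𝕜 H X 𝕜] :
    Set (StrongDual 𝕜 H) :=
  Set.range (deltaFunctional (X := X) H)

/-- `M`, a subset of the real normed space `V`, is a smooth embedded `n`-dimensional submanifold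
of `V` that is diffeomorphic to `N`: the subspace topology of `M` underlies a smooth
`n`-manifold structure for which the inclusion `M → V` is a smooth embedding, and `M` with this
structure is diffeomorphic to `N`. -/
def IsEmbeddedSubmanifoldDiffeomorphicTo {V : Type*} [NormedAddCommGroup V] [NormedSpace ℝ V]
    (M : Set V) (n : ℕ) (N : Type*) [TopologicalSpace N]
    [ChartedSpace (EuclideanSpace ℝ (Fin n)) N] : Prop :=
  ∃ (_ : ChartedSpace (EuclideanSpace ℝ (Fin n)) M) (_ : IsManifold (𝓡 n) ∞ M),
    IsSmoothEmbedding (𝓡 n) 𝓘(ℝ, V) ∞ (Subtype.val : M → V) ∧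
      Nonempty (N ≃ₘ^∞⟮𝓡 n, 𝓡 n⟯ M)

/-! The delta functions are made to factor as `δ_a = f (F a)`, with `F : ℝⁿ → N` a continuous
surjection and `f : N → H*` a smooth embedding; then the set of deltas is `f(N)`. `F` need not be
injective or smooth.

For `F`, cut `ℝⁿ` into slabs, each covering one of countably many small balls of `N` and then
following a path to the centre of the next. For `f`, take locally finite smooth functions `κ_j`,
namely bumps and bumps times chart coordinates, and put `f y = ∑ κ_j(y) δ_j`. The space `H` has
feature vectors `∑ κ_j(F a) e_j` in `ℓ²(J)`.

Continuous linear functionals on `H*` recover each `κ_j`. Dividing coordinate terms by their bump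
gives a continuous local inverse of `f`. Where the bump is 1, a linear map carries `f` to a chart,
so `f` is locally a graph and hence an immersion. -/

/-! ### Kernels as complements of immersions -/

/-- Two continuous linear maps that are both inverted by a common section, up to automorphisms of
the target, have isomorphic kernels. -/
theorem ContinuousLinearMap.nonempty_ker_equiv_ker_of_common_section {V E : Type*}
    [NormedAddCommGroup V] [NormedSpace ℝ V] [NormedAddCommGroup E] [NormedSpace ℝ E]
    (P Q : V →L[ℝ] E) (S : E →L[ℝ] V) (a b : E →L[ℝ] E)
    (ha : ∀ u, a (P (S u)) = u) (ha' : ∀ u, P (S (a u)) = u)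
    (hb : ∀ u, b (Q (S u)) = u) (hb' : ∀ u, Q (S (b u)) = u) :
    Nonempty (P.ker ≃L[ℝ] Q.ker) := by
  have h1 : ∀ v : P.ker, ((ContinuousLinearMap.id ℝ V - S ∘L b ∘L Q) ∘L P.ker.subtypeL) v ∈
      Q.ker := fun v => by simp [hb']
  have h2 : ∀ v : Q.ker, ((ContinuousLinearMap.id ℝ V - S ∘L a ∘L P) ∘L Q.ker.subtypeL) v ∈
      P.ker := fun v => by simp [ha']
  refine ⟨ContinuousLinearEquiv.equivOfInverse
    (((ContinuousLinearMap.id ℝ V - S ∘L b ∘L Q) ∘L P.ker.subtypeL).codRestrict _ h1)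
    (((ContinuousLinearMap.id ℝ V - S ∘L a ∘L P) ∘L Q.ker.subtypeL).codRestrict _ h2) ?_ ?_⟩
  · rintro ⟨v, hv⟩
    have hv : P v = 0 := hv
    ext
    simp [hv, ha]
  · rintro ⟨v, hv⟩
    have hv : Q v = 0 := hv
    ext
    simp [hv, hb]

theorem Module.End.exists_inverse_of_not_hasEigenvalue {E : Type*}
    [NormedAddCommGroup E] [NormedSpace ℝ E] [FiniteDimensional ℝ E] (A : E →L[ℝ] E)
    (h : ¬ Module.End.HasEigenvalue (A : E →ₗ[ℝ] E) 0) :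
    ∃ a : E →L[ℝ] E, (∀ u, a (A u) = u) ∧ ∀ u, A (a u) = u := by
  have hinj : Function.Injective (A : E →ₗ[ℝ] E) := by
    rw [← LinearMap.ker_eq_bot]
    by_contra hne
    refine h ?_
    change Module.End.eigenspace _ 0 ≠ ⊥
    rwa [Module.End.eigenspace_zero]
  let e := LinearEquiv.ofInjectiveEndo (A : E →ₗ[ℝ] E) hinj
  refine ⟨LinearMap.toContinuousLinearMap (e.symm : E →ₗ[ℝ] E), fun u => ?_, fun u => ?_⟩
  · exact e.symm_apply_apply u
  · exact e.apply_symm_apply u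

/-- Kernels of two surjections onto the same finite-dimensional space are isomorphic. -/
theorem ContinuousLinearMap.nonempty_ker_equiv_ker {V E : Type*}
    [NormedAddCommGroup V] [NormedSpace ℝ V] [NormedAddCommGroup E] [NormedSpace ℝ E]
    [FiniteDimensional ℝ E] (P Q : V →L[ℝ] E) (s t : E →L[ℝ] V)
    (hs : ∀ u, P (s u) = u) (ht : ∀ u, Q (t u) = u) :
    Nonempty (P.ker ≃L[ℝ] Q.ker) := by
  have hA := Module.End.finite_hasEigenvalue ((P ∘L t : E →L[ℝ] E) : E →ₗ[ℝ] E)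
  have hB := Module.End.finite_hasEigenvalue ((Q ∘L s : E →L[ℝ] E) : E →ₗ[ℝ] E)
  -- With `S = c s + t`, `P S = c + P t` and `Q S = 1 + c Q s`. Both are invertible once `-c` is not
  -- an eigenvalue of `P t`, `-c⁻¹` is not one of `Q s`, and `c ≠ 0`; this excludes finitely many
  -- `c`.
  obtain ⟨c, hc⟩ := ((hA.image (fun r : ℝ => -r)).union
    ((hB.image (fun r : ℝ => -r⁻¹)).union (Set.finite_singleton 0))).exists_notMem
  simp only [Set.mem_union, Set.mem_image, Set.mem_singleton_iff, not_or, not_exists,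
    not_and] at hc
  obtain ⟨hc1, hc2, hc0⟩ := hc
  have key1 : ¬ Module.End.HasEigenvalue
      ((P ∘L (c • s + t) : E →L[ℝ] E) : E →ₗ[ℝ] E) 0 := by
    intro h
    obtain ⟨v, hv⟩ := h.exists_hasEigenvector
    refine hc1 (-c) (Module.End.hasEigenvalue_of_hasEigenvector (x := v) ?_) (by simp)
    rw [Module.End.hasEigenvector_iff, Module.End.mem_eigenspace_iff]
    refine ⟨?_, hv.2⟩
    have := hv.apply_eq_smul
    simp [hs] at this
    simp only [coe_coe, coe_comp, Function.comp_apply]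
    rw [neg_smul, eq_neg_iff_add_eq_zero, add_comm]
    exact this
  have key2 : ¬ Module.End.HasEigenvalue
      ((Q ∘L (c • s + t) : E →L[ℝ] E) : E →ₗ[ℝ] E) 0 := by
    intro h
    obtain ⟨v, hv⟩ := h.exists_hasEigenvector
    refine hc2 (-c⁻¹) (Module.End.hasEigenvalue_of_hasEigenvector (x := v) ?_) (by simp)
    rw [Module.End.hasEigenvector_iff, Module.End.mem_eigenspace_iff]
    refine ⟨?_, hv.2⟩
    have := hv.apply_eq_smul
    simp [ht] at this
    simp only [coe_coe, coe_comp, Function.comp_apply]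
    rw [neg_smul, eq_neg_iff_add_eq_zero]
    have h2 := congrArg (fun w => c⁻¹ • w) this
    simpa [smul_smul, inv_mul_cancel₀ hc0] using h2
  obtain ⟨a, ha, ha'⟩ := Module.End.exists_inverse_of_not_hasEigenvalue _ key1
  obtain ⟨b, hb, hb'⟩ := Module.End.exists_inverse_of_not_hasEigenvalue _ key2
  exact nonempty_ker_equiv_ker_of_common_section P Q (c • s + t) a b ha ha' hb hb'

/-! ### Immersions and embedded images -/

open Topology in
/-- A smooth map into a normed space that a continuous linear map carries to a chart is, locally,
the graph of a smooth map, hence an immersion. -/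
theorem isImmersionAtOfComplement_of_linear_comp_eq_chart {V E M : Type*}
    [NormedAddCommGroup V] [NormedSpace ℝ V] [NormedAddCommGroup E] [NormedSpace ℝ E]
    [TopologicalSpace M] [ChartedSpace E M] [IsManifold 𝓘(ℝ, E) ∞ M]
    {f : M → V} (hf : ContMDiff 𝓘(ℝ, E) 𝓘(ℝ, V) ∞ f) {x : M}
    {φ : OpenPartialHomeomorph M E} (hφ : φ ∈ IsManifold.maximalAtlas 𝓘(ℝ, E) ∞ M)
    (hx : x ∈ φ.source) (P : V →L[ℝ] E) (s : E →L[ℝ] V) (hs : ∀ u, P (s u) = u)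
    (hP : ∀ᶠ y in 𝓝 x, P (f y) = φ y) :
    IsImmersionAtOfComplement P.ker 𝓘(ℝ, E) 𝓘(ℝ, V) ∞ f x := by
  obtain ⟨O, hO, hOo, hxO⟩ := eventually_nhds_iff.mp hP
  set ψ := φ.restr O with hψ
  have hψmem : ψ ∈ IsManifold.maximalAtlas 𝓘(ℝ, E) ∞ M :=
    restr_mem_maximalAtlas (contDiffGroupoid ∞ 𝓘(ℝ, E)) hφ hOo
  have hxψ : x ∈ ψ.source := by simp [hψ, hOo.interior_eq, hx, hxO]
  have hψsub : ∀ y ∈ ψ.source, P (f y) = ψ y := by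
    intro y hy
    have : y ∈ O := by
      have := hy
      simp only [hψ, φ.restr_source, hOo.interior_eq] at this
      exact this.2
    exact hO y this
  let g : E → V := fun u => f (ψ.symm u) - s u
  have hg : ContDiffOn ℝ ∞ g ψ.target := by
    refine ContDiffOn.sub ?_ s.contDiff.contDiffOn
    exact contMDiffOn_iff_contDiffOn.mp
      (hf.comp_contMDiffOn (contMDiffOn_symm_of_mem_maximalAtlas hψmem))
  have hPg : ∀ u ∈ ψ.target, P (g u) = 0 := by
    intro u hu
    simp only [g, map_sub, hs]
    rw [hψsub _ (ψ.map_target hu), ψ.right_inv hu, sub_self]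
  have hgP : ContDiffOn ℝ ∞ (fun v => g (P v)) (P ⁻¹' ψ.target) :=
    hg.comp P.contDiff.contDiffOn (fun v hv => hv)
  -- A shear along `ker P`: since `P ∘ g = 0` it preserves `P`, so reversing the sign inverts it. It
  -- flattens the graph `s u + g u` to `s u`.
  let Ψ : OpenPartialHomeomorph V V :=
    { toFun := fun v => v - g (P v)
      invFun := fun v => v + g (P v)
      source := P ⁻¹' ψ.target
      target := P ⁻¹' ψ.target
      map_source' := fun v hv => by simpa [hPg _ hv] using hv
      map_target' := fun v hv => by simpa [hPg _ hv] using hv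
      left_inv' := fun v hv => by simp [hPg _ hv]
      right_inv' := fun v hv => by simp [hPg _ hv]
      open_source := ψ.open_target.preimage P.continuous
      open_target := ψ.open_target.preimage P.continuous
      continuousOn_toFun := continuousOn_id.sub hgP.continuousOn
      continuousOn_invFun := continuousOn_id.add hgP.continuousOn }
  have hΨ : Ψ ∈ IsManifold.maximalAtlas 𝓘(ℝ, V) ∞ V := by
    refine StructureGroupoid.mem_maximalAtlas_of_mem_groupoid _ ?_
    rw [contDiffGroupoid, mem_groupoid_of_pregroupoid]
    constructor
    · simpa [contDiffPregroupoid, Ψ] using contDiffOn_id.sub hgP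
    · simpa [contDiffPregroupoid, Ψ] using contDiffOn_id.add hgP
  refine IsImmersionAtOfComplement.mk_of_continuousAt hf.continuous.continuousAt
    (ContinuousLinearEquiv.equivOfRightInverse P s hs).symm ψ Ψ hxψ ?_ hψmem hΨ ?_
  · change P (f x) ∈ ψ.target
    rw [hψsub x hxψ]
    exact ψ.map_source hxψ
  · intro u hu
    have hu : u ∈ ψ.target := by simpa using hu
    have h1 : P (f (ψ.symm u)) = u := by
      rw [hψsub _ (ψ.map_target hu), ψ.right_inv hu]
    have h2 : (ContinuousLinearEquiv.equivOfRightInverse P s hs).symm (u, 0) = s u := by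
      rw [ContinuousLinearEquiv.equivOfRightInverse_symm_apply]
      simp
    simp only [Function.comp_apply]
    rw [h2]
    change f (ψ.symm u) - g (P (f (ψ.symm u))) = s u
    rw [h1]
    simp [g]

open Topology in
/-- A homeomorphism onto a manifold transports the manifold structure to its domain. -/
theorem Homeomorph.exists_isManifold {E M N : Type*} [NormedAddCommGroup E] [NormedSpace ℝ E]
    [TopologicalSpace M] [TopologicalSpace N] [ChartedSpace E N] [IsManifold 𝓘(ℝ, E) ∞ N]
    (e : M ≃ₜ N) :
    ∃ (_ : ChartedSpace E M) (_ : IsManifold 𝓘(ℝ, E) ∞ M),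
      ContMDiff 𝓘(ℝ, E) 𝓘(ℝ, E) ∞ e ∧ ContMDiff 𝓘(ℝ, E) 𝓘(ℝ, E) ∞ e.symm ∧
        ∀ φ ∈ atlas E N, e.transOpenPartialHomeomorph φ ∈ atlas E M := by
  let cs : ChartedSpace E M :=
    { atlas := (fun φ => e.transOpenPartialHomeomorph φ) '' atlas E N
      chartAt := fun x => e.transOpenPartialHomeomorph (chartAt E (e x))
      mem_chart_source := fun x => by simp
      chart_mem_atlas := fun x => ⟨_, chart_mem_atlas E (e x), rfl⟩ }
  have hg : HasGroupoid M (contDiffGroupoid ∞ 𝓘(ℝ, E)) := by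
    constructor
    rintro _ _ ⟨φ, hφ, rfl⟩ ⟨φ', hφ', rfl⟩
    have h : (e.transOpenPartialHomeomorph φ).symm ≫ₕ e.transOpenPartialHomeomorph φ' =
        φ.symm ≫ₕ φ' := by
      refine OpenPartialHomeomorph.ext _ _ (fun x => ?_) (fun x => ?_) ?_
      · simp
      · simp
      · ext x
        simp
    rw [h]
    exact HasGroupoid.compatible hφ hφ'
  have hm : IsManifold 𝓘(ℝ, E) ∞ M := IsManifold.mk' _ _ _
  refine ⟨cs, hm, fun x => ?_, fun y => ?_, fun φ hφ => ⟨φ, hφ, rfl⟩⟩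
  · have h1 := contMDiffOn_chart (I := 𝓘(ℝ, E)) (n := ∞) (x := x)
    have h2 := contMDiffOn_chart_symm (I := 𝓘(ℝ, E)) (n := ∞) (x := e x)
    have h3 := h2.comp h1 (fun z hz => (chartAt E x).map_source hz)
    refine ((h3 x (mem_chart_source E x)).contMDiffAt
      (chart_source_mem_nhds E x)).congr_of_eventuallyEq ?_
    filter_upwards [chart_source_mem_nhds E x] with z hz
    exact ((chartAt E (e x)).left_inv hz).symm
  · have h1 := contMDiffOn_chart (I := 𝓘(ℝ, E)) (n := ∞) (x := y)
    have hmem : e.transOpenPartialHomeomorph (chartAt E y) ∈ IsManifold.maximalAtlas 𝓘(ℝ, E) ∞ M :=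
      IsManifold.subset_maximalAtlas ⟨_, chart_mem_atlas E y, rfl⟩
    have h2 := contMDiffOn_symm_of_mem_maximalAtlas hmem
    have h3 := h2.comp h1 (fun z hz => (chartAt E y).map_source hz)
    refine ((h3 y (mem_chart_source E y)).contMDiffAt
      (chart_source_mem_nhds E y)).congr_of_eventuallyEq ?_
    filter_upwards [chart_source_mem_nhds E y] with z hz
    have := (chartAt E y).left_inv hz
    simp [this]

open Topology in
-- The range of `P` is a subspace containing a neighbourhood of `φ x`, hence everything.
theorem ContinuousLinearMap.exists_section_of_eventually_eq_chart {V E N : Type*}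
    [NormedAddCommGroup V] [NormedSpace ℝ V] [NormedAddCommGroup E] [NormedSpace ℝ E]
    [FiniteDimensional ℝ E] [TopologicalSpace N] {f : N → V} {x : N}
    {φ : OpenPartialHomeomorph N E} (hx : x ∈ φ.source) (P : V →L[ℝ] E)
    (hP : ∀ᶠ y in 𝓝 x, P (f y) = φ y) : ∃ s : E →L[ℝ] V, ∀ u, P (s u) = u := by
  have hmem : (P.range : Set E) ∈ 𝓝 (φ x) := by
    rw [← φ.map_nhds_eq hx, Filter.mem_map]
    filter_upwards [hP] with y hy
    exact ⟨f y, hy⟩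
  have htop : P.range = ⊤ :=
    Submodule.eq_top_of_nonempty_interior' _ ⟨φ x, mem_interior_iff_mem_nhds.mpr hmem⟩
  obtain ⟨s, hs⟩ := P.exists_rightInverse_of_surjective htop
  exact ⟨s, fun u => congr($hs u)⟩

open Topology in
/-- The image of a smooth topological embedding that is locally inverted by continuous linear maps
followed by charts is an embedded submanifold. -/
theorem isEmbeddedSubmanifoldDiffeomorphicTo_range {V : Type*} [NormedAddCommGroup V]
    [NormedSpace ℝ V] {n : ℕ} {N : Type*} [TopologicalSpace N] [Nonempty N]
    [ChartedSpace (EuclideanSpace ℝ (Fin n)) N] [IsManifold (𝓡 n) ∞ N]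
    {f : N → V} (hf : ContMDiff (𝓡 n) 𝓘(ℝ, V) ∞ f) (hemb : IsEmbedding f)
    (hgraph : ∀ x, ∃ φ ∈ atlas (EuclideanSpace ℝ (Fin n)) N, x ∈ φ.source ∧
      ∃ P : V →L[ℝ] EuclideanSpace ℝ (Fin n), ∀ᶠ y in 𝓝 x, P (f y) = φ y) :
    IsEmbeddedSubmanifoldDiffeomorphicTo (Set.range f) n N := by
  let e : Set.range f ≃ₜ N := hemb.toHomeomorph.symm
  have hval : ∀ m, f (e m) = m := fun m =>
    congrArg Subtype.val (hemb.toHomeomorph.apply_symm_apply m)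
  obtain ⟨cs, hm, he, he', hatlas⟩ := e.exists_isManifold (E := EuclideanSpace ℝ (Fin n))
  have hsmooth : ContMDiff (𝓡 n) 𝓘(ℝ, V) ∞ (Subtype.val : Set.range f → V) :=
    (hf.comp he).congr fun m => (hval m).symm
  obtain ⟨x₀⟩ := ‹Nonempty N›
  -- One complement must serve at all points, so every `ker P` is identified with the kernel at a
  -- base point.
  obtain ⟨φ₀, -, hx₀, P₀, hP₀⟩ := hgraph x₀
  obtain ⟨s₀, hs₀⟩ := P₀.exists_section_of_eventually_eq_chart hx₀ hP₀
  refine ⟨cs, hm, ⟨?_, IsEmbedding.subtypeVal⟩,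
    ⟨{ toEquiv := e.symm.toEquiv, contMDiff_toFun := he', contMDiff_invFun := he }⟩⟩
  refine IsImmersionOfComplement.isImmersion (F := P₀.ker) fun m => ?_
  obtain ⟨φ, hφ, hxφ, P, hP⟩ := hgraph (e m)
  obtain ⟨s, hs⟩ := P.exists_section_of_eventually_eq_chart hxφ hP
  obtain ⟨T⟩ := P.nonempty_ker_equiv_ker P₀ s s₀ hs hs₀
  refine IsImmersionAtOfComplement.trans_F ?_ T
  refine isImmersionAtOfComplement_of_linear_comp_eq_chart hsmooth
    (φ := e.transOpenPartialHomeomorph φ) (IsManifold.subset_maximalAtlas (hatlas φ hφ))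
    hxφ P s hs ?_
  filter_upwards [e.continuous.continuousAt.eventually hP] with y hy
  rw [← hval y]
  exact hy

open Topology in
-- Near `f x`, the map `v ↦ φ.symm ((p v)⁻¹ • P v)` is a continuous left inverse. As `p ∘ f`
-- vanishes off the chart, points far from `x` cannot have values near `f x`.
theorem isInducing_of_locally_recovered {E V N : Type*} [NormedAddCommGroup E] [NormedSpace ℝ E]
    [TopologicalSpace V] [TopologicalSpace N] {f : N → V} (hf : Continuous f)
    (h : ∀ x, ∃ (φ : OpenPartialHomeomorph N E) (p : V → ℝ) (P : V → E), Continuous p ∧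
      Continuous P ∧ p (f x) ≠ 0 ∧ (∀ y, p (f y) ≠ 0 → y ∈ φ.source) ∧
      ∀ y, P (f y) = p (f y) • φ y) : IsInducing f := by
  rw [isInducing_iff_nhds]
  intro x
  refine le_antisymm hf.continuousAt.tendsto.le_comap ?_
  obtain ⟨φ, p, P, hp, hP, hpx, hsource, hφ⟩ := h x
  have hcont : ContinuousAt (fun v => φ.symm ((p v)⁻¹ • P v)) (f x) := by
    have h1 : ContinuousAt (fun v => (p v)⁻¹ • P v) (f x) :=
      (hp.continuousAt.inv₀ hpx).smul hP.continuousAt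
    have h2 : (p (f x))⁻¹ • P (f x) = φ x := by rw [hφ, inv_smul_smul₀ hpx]
    refine ContinuousAt.comp (g := φ.symm) ?_ h1
    rw [h2]
    exact φ.continuousAt_symm (φ.map_source (hsource x hpx))
  have hx : φ.symm ((p (f x))⁻¹ • P (f x)) = x := by
    rw [hφ, inv_smul_smul₀ hpx, φ.left_inv (hsource x hpx)]
  have h3 := hcont.tendsto.comp (Filter.tendsto_comap (f := f))
  rw [hx] at h3
  have h4 : ∀ᶠ y in Filter.comap f (𝓝 (f x)), p (f y) ≠ 0 :=
    Filter.tendsto_comap.eventually (hp.continuousAt.eventually_ne hpx)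
  refine (Filter.tendsto_id'.mp (h3.congr' ?_))
  filter_upwards [h4] with y hy
  simp [hφ, inv_smul_smul₀ hy, φ.left_inv (hsource y hy)]

/-! ### A continuous surjection from `ℝⁿ` -/

open Topology in
theorem exists_continuous_image_ball_mem_nhds {E N : Type*} [NormedAddCommGroup E]
    [NormedSpace ℝ E] [TopologicalSpace N] [ChartedSpace E N] (q : N) {r : ℝ} (hr : 0 < r) :
    ∃ B : E → N, Continuous B ∧ B 0 = q ∧ B '' Metric.ball 0 r ∈ 𝓝 q := by
  let φ := chartAt E q
  obtain ⟨ρ, hρ, hsub⟩ := Metric.isOpen_iff.mp φ.open_target (φ q) (mem_chart_target E q)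
  let u := OpenPartialHomeomorph.univBall (φ q) ρ
  have hus : u.source = Set.univ := OpenPartialHomeomorph.univBall_source _ _
  have hu0 : u 0 = φ q := OpenPartialHomeomorph.univBall_apply_zero _ _
  have hut : ∀ v, u v ∈ φ.target := fun v => hsub (by
    rw [← OpenPartialHomeomorph.univBall_target (φ q) hρ]
    exact u.map_source (by simp [hus]))
  have hq : φ.symm (φ q) = q := φ.left_inv (mem_chart_source E q)
  refine ⟨fun v => φ.symm (u v), ?_, by simp only [hu0, hq], ?_⟩
  · exact φ.continuousOn_symm.comp_continuous
      (OpenPartialHomeomorph.continuous_univBall (φ q) ρ) hut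
  · have h1 : Filter.map u (𝓝 0) = 𝓝 (φ q) := by
      rw [u.map_nhds_eq (by simp [hus]), hu0]
    have h2 : Filter.map φ.symm (𝓝 (φ q)) = 𝓝 q := by
      rw [φ.symm.map_nhds_eq (mem_chart_target E q), hq]
    rw [← h2, ← h1, Filter.map_map]
    exact Filter.image_mem_map (Metric.ball_mem_nhds 0 hr)

open Topology in
/-- A map which is constant on both sides of a slab and whose values inside the slab cover the
image of a small ball under a given map. -/
theorem exists_continuous_slab {E N : Type*} [NormedAddCommGroup E] [NormedSpace ℝ E]
    [TopologicalSpace N] (t : E →L[ℝ] ℝ) (ht : ∀ v, |t v| ≤ ‖v‖) (e : E) (he : t e = 1)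
    {B : E → N} (hB : Continuous B) {q q' : N} (hq : B 0 = q) (γ : Path q q') (k : ℝ) :
    ∃ G : E → N, Continuous G ∧ (∀ x, t x ≤ k → G x = q) ∧ (∀ x, k + 1 ≤ t x → G x = q') ∧
      ∀ v ∈ Metric.ball (0 : E) (1 / 8), ∃ x, k ≤ t x ∧ t x < k + 1 ∧ G x = B v := by
  -- A plateau: 1 within 1/8 of 1/4, and 0 beyond distance 1/4. The ball of radius 1/8 about `c`
  -- stays in the plateau, where `B` is applied undistorted; the half slab `[1/2, 1]` is left for
  -- the path.
  let β : ℝ → ℝ := fun s => max 0 (min 1 (2 - 8 * |s - 1 / 4|))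
  have hβ : Continuous β := by fun_prop
  let c : E := (k + 1 / 4) • e
  have hβ0 : ∀ s, s ≤ 0 → β s = 0 := by
    intro s hs
    refine max_eq_left ((min_le_right _ _).trans ?_)
    rw [abs_of_nonpos (by linarith)]
    linarith
  have hβ2 : β (1 / 2) = 0 := by
    refine max_eq_left ((min_le_right _ _).trans ?_)
    rw [abs_of_nonneg (by norm_num)]
    norm_num
  refine ⟨fun x => if t x - k ≤ 1 / 2 then B (β (t x - k) • (x - c)) else
    γ.extend (2 * (t x - k) - 1), ?_, ?_, ?_, ?_⟩
  · refine Continuous.if_le ?_ ?_ (by fun_prop) (by fun_prop) ?_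
    · fun_prop
    · exact γ.continuous_extend.comp (by fun_prop)
    · intro x hx
      rw [hx, hβ2, zero_smul, hq]
      norm_num
  · intro x hx
    simp only
    rw [if_pos (by linarith), hβ0 _ (by linarith), zero_smul, hq]
  · intro x hx
    simp only
    rw [if_neg (by linarith), γ.extend_of_one_le (by linarith)]
  · intro v hv
    have hv : |t v| < 1 / 8 := (ht v).trans_lt (by simpa using hv)
    obtain ⟨h1, h2⟩ := abs_lt.mp hv
    have htx : t (c + v) = k + 1 / 4 + t v := by simp [c, he]
    refine ⟨c + v, by rw [htx]; linarith, by rw [htx]; linarith, ?_⟩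
    have hs : t (c + v) - k = 1 / 4 + t v := by rw [htx]; ring
    have hβ1 : β (1 / 4 + t v) = 1 := by
      have : (1 : ℝ) ≤ 2 - 8 * |1 / 4 + t v - 1 / 4| := by
        rw [add_sub_cancel_left]; linarith
      simp only [β]
      rw [min_eq_left this]
      norm_num
    simp only [hs]
    rw [if_pos (by linarith), hβ1, one_smul, add_sub_cancel_left]

open Topology in
/-- Maps that are constant outside consecutive slabs, with matching constants, glue. -/
theorem continuous_glue_slabs {E N : Type*} [TopologicalSpace E] [TopologicalSpace N] {t : E → ℝ}
    (ht : Continuous t) {q : ℤ → N} {G : ℤ → E → N} (hG : ∀ k, Continuous (G k))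
    (h0 : ∀ (k : ℤ) x, t x ≤ k → G k x = q k) (h1 : ∀ (k : ℤ) x, (k : ℝ) + 1 ≤ t x → G k x = q (k + 1)) :
    Continuous fun x => G ⌊t x⌋ x := by
  have hlf : LocallyFinite fun k : ℤ => Set.Icc (k : ℝ) (k + 1) := by
    intro a
    refine ⟨Set.Ioo (a - 1) (a + 1), Ioo_mem_nhds (by linarith) (by linarith),
      (Set.finite_Icc ⌊a - 2⌋ ⌈a + 1⌉).subset ?_⟩
    rintro k ⟨y, ⟨hy1, hy2⟩, hy3, hy4⟩
    constructor
    · have : (⌊a - 2⌋ : ℝ) ≤ k := (Int.floor_le (a - 2)).trans (by linarith)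
      exact_mod_cast this
    · have : (k : ℝ) ≤ ⌈a + 1⌉ := le_trans (by linarith) (Int.le_ceil (a + 1))
      exact_mod_cast this
  refine (hlf.preimage_continuous ht).continuous ?_ (fun k => isClosed_Icc.preimage ht) fun k => ?_
  · refine Set.eq_univ_of_forall fun x => Set.mem_iUnion.mpr ⟨⌊t x⌋, Int.floor_le _, ?_⟩
    exact (Int.lt_floor_add_one _).le
  · refine (hG k).continuousOn.congr fun x hx => ?_
    obtain ⟨hx1, hx2⟩ := hx
    rcases hx2.lt_or_eq with hlt | heq
    · have : ⌊t x⌋ = k := Int.floor_eq_iff.mpr ⟨hx1, hlt⟩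
      simp only [this]
    -- On the common wall the floor has already jumped; both neighbours take the value `q (k + 1)`
    -- there.
    · have : ⌊t x⌋ = k + 1 := by rw [heq]; exact_mod_cast Int.floor_intCast (k + 1)
      simp only [this]
      rw [h0 _ _ (by push_cast; exact heq.le), h1 _ _ heq.ge]

open Topology in
/-- Every connected second countable manifold of dimension `n` is a continuous image of `ℝⁿ`. -/
theorem exists_continuous_surjective_euclideanSpace (n : ℕ) (N : Type*) [TopologicalSpace N]
    [SecondCountableTopology N] [ConnectedSpace N] [ChartedSpace (EuclideanSpace ℝ (Fin n)) N] :
    ∃ F : EuclideanSpace ℝ (Fin n) → N, Continuous F ∧ Function.Surjective F := by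
  rcases n with _ | n
  · have : DiscreteTopology N := ChartedSpace.discreteTopology (EuclideanSpace ℝ (Fin 0)) N
    have hsub : Subsingleton N := PreconnectedSpace.trivial_of_discrete
    obtain ⟨y⟩ := (inferInstance : Nonempty N)
    exact ⟨fun _ => y, continuous_const, fun z => ⟨0, Subsingleton.elim _ _⟩⟩
  have : LocallyPathConnectedSpace N :=
    ChartedSpace.locallyPathConnectedSpace (EuclideanSpace ℝ (Fin (n + 1))) N
  have : PathConnectedSpace N := pathConnectedSpace_iff_connectedSpace.mpr inferInstance
  let t : EuclideanSpace ℝ (Fin (n + 1)) →L[ℝ] ℝ := EuclideanSpace.proj 0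
  have ht : ∀ v, |t v| ≤ ‖v‖ := fun v => PiLp.norm_apply_le v 0
  have he : t (EuclideanSpace.single 0 1) = 1 := by simp [t]
  choose B hBc hB0 hBn using fun q : N => exists_continuous_image_ball_mem_nhds
    (E := EuclideanSpace ℝ (Fin (n + 1))) q (r := 1 / 8) (by norm_num)
  obtain ⟨s, hs, hcov⟩ := TopologicalSpace.countable_cover_nhds hBn
  have hne : s.Nonempty := by
    obtain ⟨y⟩ := (inferInstance : Nonempty N)
    have hy : y ∈ ⋃ x ∈ s, B x '' Metric.ball 0 (1 / 8) := hcov ▸ Set.mem_univ y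
    obtain ⟨x, hx, -⟩ := Set.mem_iUnion₂.mp hy
    exact ⟨x, hx⟩
  obtain ⟨p, rfl⟩ := hs.exists_eq_range hne
  -- Negative slabs just repeat `p 0`; the nonnegative ones already cover `N`.
  let q : ℤ → N := fun k => p k.toNat
  choose G hGc hG0 hG1 hGB using fun k : ℤ => exists_continuous_slab t ht _ he (hBc (q k))
    (hB0 (q k)) (PathConnectedSpace.somePath (q k) (q (k + 1))) k
  refine ⟨fun x => G ⌊t x⌋ x, continuous_glue_slabs t.continuous hGc hG0 hG1, fun y => ?_⟩
  have hy : y ∈ ⋃ x ∈ Set.range p, B x '' Metric.ball 0 (1 / 8) := hcov ▸ Set.mem_univ y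
  obtain ⟨_, ⟨i, rfl⟩, v, hv, rfl⟩ := Set.mem_iUnion₂.mp hy
  obtain ⟨x, hx1, hx2, hx3⟩ := hGB (i : ℤ) v hv
  refine ⟨x, ?_⟩
  have : ⌊t x⌋ = (i : ℤ) := Int.floor_eq_iff.mpr ⟨hx1, hx2⟩
  simp only [this]
  exact hx3

/-! ### The reproducing kernel Hilbert space -/

/-- A pointwise finite family of real functions on `X` gives a reproducing kernel Hilbert space
containing these functions, in which evaluations are combinations of fixed functionals with the
values of the family as coefficients. -/
theorem exists_rkhs_of_pointwise_finite (𝕜 : Type) [RCLike 𝕜] {X J : Type} (k : X → J → ℝ)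
    (hfin : ∀ a, (Function.support (k a)).Finite) :
    ∃ (H : Type) (_ : NormedAddCommGroup H) (_ : InnerProductSpace 𝕜 H) (_ : CompleteSpace H)
      (_ : RKHS 𝕜 H X 𝕜) (δ : J → StrongDual 𝕜 H) (h : J → H),
      (∀ a, deltaFunctional H a = ∑ᶠ j, k a j • δ j) ∧
        ∀ a j, deltaFunctional H a (h j) = (k a j : 𝕜) := by
  classical
  let e : J → lp (fun _ : J => 𝕜) 2 := fun j => lp.single 2 j (1 : 𝕜)
  have hee : ∀ i j, inner 𝕜 (e i) (e j) = if i = j then (1 : 𝕜) else 0 := by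
    intro i j
    simp only [e]
    rw [lp.inner_single_left]
    by_cases hij : i = j
    · subst hij
      simp
    · rw [if_neg hij, lp.single_apply_ne _ _ _ hij]
      simp
  let K : X → lp (fun _ : J => 𝕜) 2 := fun a => ∑ j ∈ (hfin a).toFinset, (k a j : 𝕜) • e j
  have hK : ∀ a j, inner 𝕜 (K a) (e j) = (k a j : 𝕜) := by
    intro a j
    simp only [K, sum_inner, inner_smul_left, hee, RCLike.conj_ofReal, mul_ite, mul_one, mul_zero,
      Finset.sum_ite_eq', Set.Finite.mem_toFinset, Function.mem_support]
    split_ifs with h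
    · rfl
    · simp [not_not.mp h]
  -- Restricting to the closed span of the feature vectors makes evaluation injective: a vector of
  -- `S` orthogonal to all `K a` is zero.
  let S : Submodule 𝕜 (lp (fun _ : J => 𝕜) 2) := (Submodule.span 𝕜 (Set.range K)).topologicalClosure
  have hKS : ∀ a, K a ∈ S := fun a =>
    Submodule.le_topologicalClosure _ (Submodule.subset_span ⟨a, rfl⟩)
  have : CompleteSpace S := (Submodule.isClosed_topologicalClosure _).completeSpace_coe
  let ev : S →L[𝕜] X → 𝕜 := ContinuousLinearMap.pi fun a => innerSL 𝕜 (K a) ∘L S.subtypeL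
  have hev : Function.Injective ev := by
    refine (injective_iff_map_eq_zero ev).mpr fun f hf => ?_
    have hperp : (f : lp (fun _ : J => 𝕜) 2) ∈ Sᗮ := by
      simp only [S, Submodule.orthogonal_closure]
      rw [Submodule.mem_orthogonal]
      intro u hu
      induction hu using Submodule.span_induction with
      | mem u hu => obtain ⟨a, rfl⟩ := hu; exact congrFun hf a
      | zero => simp
      | add u v _ _ hu hv => rw [inner_add_left, hu, hv, add_zero]
      | smul c u _ hu => rw [inner_smul_left, hu, mul_zero]
    have := Submodule.inner_right_of_mem_orthogonal f.2 hperp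
    exact Subtype.ext (inner_self_eq_zero.mp this)
  let _ : RKHS 𝕜 S X 𝕜 := ⟨ev, hev⟩
  -- Projecting `e j` to `S` does not change its pairing with `K a`, which lies in `S`.
  refine ⟨S, inferInstance, inferInstance, inferInstance, inferInstance,
    fun j => innerSL 𝕜 (e j) ∘L S.subtypeL, fun j => S.orthogonalProjectionOnto (e j), ?_, ?_⟩
  · intro a
    rw [finsum_eq_sum_of_support_subset (s := (hfin a).toFinset) _ (by
      intro j hj
      simp only [Set.Finite.coe_toFinset, Function.mem_support]
      rintro h
      exact hj ((congrArg (· • _) h).trans (zero_smul ℝ (innerSL 𝕜 (e j) ∘L S.subtypeL))))]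
    ext f
    change inner 𝕜 (K a) (f : lp (fun _ : J => 𝕜) 2) = _
    simp only [K, sum_inner, inner_smul_left, RCLike.conj_ofReal]
    simp [RCLike.real_smul_eq_coe_mul]
  · intro a j
    change inner 𝕜 (K a) (S.orthogonalProjectionOnto (e j) : lp (fun _ : J => 𝕜) 2) = _
    rw [← hK a j]
    exact S.inner_orthogonalProjectionOnto_eq_of_mem_left ⟨K a, hKS a⟩ (e j)

/-! ### Bump functions and chart coordinates -/

open Topology in
/-- A locally finite smooth family of real functions on a manifold consisting of bump functions and
of their products with chart coordinates. -/
theorem exists_locallyFinite_bump_coordinates (n : ℕ) (N : Type*) [TopologicalSpace N] [T2Space N]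
    [SecondCountableTopology N] [ChartedSpace (EuclideanSpace ℝ (Fin n)) N]
    [IsManifold (𝓡 n) ∞ N] :
    ∃ (J : Type) (κ : J → N → ℝ), (∀ j, ContMDiff (𝓡 n) 𝓘(ℝ, ℝ) ∞ (κ j)) ∧
      LocallyFinite (fun j => Function.support (κ j)) ∧
      ∀ x, ∃ φ ∈ atlas (EuclideanSpace ℝ (Fin n)) N, ∃ (j₀ : J) (j : Fin n → J),
        κ j₀ =ᶠ[𝓝 x] 1 ∧ (∀ y, κ j₀ y ≠ 0 → y ∈ φ.source) ∧
          ∀ y m, κ (j m) y = κ j₀ y * φ y m := by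
  have : LocallyCompactSpace N :=
    ChartedSpace.locallyCompactSpace (EuclideanSpace ℝ (Fin n)) N
  obtain ⟨ι, fs, -⟩ := SmoothBumpCovering.exists_isSubordinate (𝓡 n) (s := (Set.univ : Set N))
    isClosed_univ (U := fun _ => Set.univ) (fun _ _ => Filter.univ_mem)
  have hc : Countable ι := Set.countable_univ_iff.mp
    (fs.locallyFinite.countable_univ fun i => (fs i).nonempty_support)
  -- Countability lets the index set move to `Type`, whatever the universe of `N`.
  let r : Shrink.{0} ι ≃ ι := (equivShrink.{0} ι).symm
  let κ : Shrink.{0} ι × Option (Fin n) → N → ℝ := fun j y =>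
    fs (r j.1) y • j.2.elim 1 (fun m => chartAt (EuclideanSpace ℝ (Fin n)) (fs.c (r j.1)) y m)
  refine ⟨Shrink.{0} ι × Option (Fin n), κ, ?_, ?_, fun x => ?_⟩
  · rintro ⟨i, o⟩
    refine (fs (r i)).contMDiff_smul ?_
    rcases o with _ | m
    · exact contMDiffOn_const
    · exact (EuclideanSpace.proj (𝕜 := ℝ) m).contMDiff.comp_contMDiffOn contMDiffOn_chart
  · have h1 : LocallyFinite fun i => Function.support (fs (r i)) :=
      fs.locallyFinite.comp_injective r.injective
    intro x
    obtain ⟨t, ht, hfin⟩ := h1 x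
    refine ⟨t, ht, (hfin.prod (Set.finite_univ (α := Option (Fin n)))).subset ?_⟩
    rintro ⟨i, o⟩ ⟨y, hy, hyt⟩
    exact ⟨⟨y, left_ne_zero_of_smul hy, hyt⟩, Set.mem_univ _⟩
  · obtain ⟨i, hi⟩ := r.surjective (fs.ind x (Set.mem_univ x))
    have h1 : fs (r i) =ᶠ[𝓝 x] 1 := hi ▸ fs.eventuallyEq_one x (Set.mem_univ x)
    refine ⟨_, chart_mem_atlas _ (fs.c (r i)), (i, none), fun m => (i, some m), ?_, ?_, ?_⟩
    · filter_upwards [h1] with y hy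
      simpa [κ] using hy
    · intro y hy
      refine (fs (r i)).support_subset_source ?_
      simpa [κ] using hy
    · intro y m
      simp [κ]

/-! ### Assembly -/

theorem theorem0 (𝕜 : Type) [RCLike 𝕜] (n : ℕ)
    (N : Type*) [TopologicalSpace N] [T2Space N] [SecondCountableTopology N] [ConnectedSpace N]
    [ChartedSpace (EuclideanSpace ℝ (Fin n)) N] [IsManifold (𝓡 n) ∞ N] :
    ∃ (H : Type) (_ : NormedAddCommGroup H) (_ : InnerProductSpace 𝕜 H) (_ : CompleteSpace H)
      (_ : RKHS 𝕜 H (EuclideanSpace ℝ (Fin n)) 𝕜),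
      (∀ f : H, Continuous (fun x : EuclideanSpace ℝ (Fin n) => f x)) ∧
        IsEmbeddedSubmanifoldDiffeomorphicTo
          (deltaSet (X := EuclideanSpace ℝ (Fin n)) H) n N := by
  obtain ⟨F, hFc, hFs⟩ := exists_continuous_surjective_euclideanSpace n N
  obtain ⟨J, κ, hκ, hlf, hloc⟩ := exists_locallyFinite_bump_coordinates n N
  obtain ⟨H, i1, i2, i3, i4, δ, h, hδ, hh⟩ := exists_rkhs_of_pointwise_finite 𝕜
    (fun a j => κ j (F a)) (fun a => hlf.point_finite (F a))
  let f : N → StrongDual 𝕜 H := fun y => ∑ᶠ j, κ j y • δ j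
  have hf : ContMDiff (𝓡 n) 𝓘(ℝ, StrongDual 𝕜 H) ∞ f := by
    refine contMDiff_finsum (fun j => (hκ j).smul contMDiff_const) (hlf.subset fun j y hy => ?_)
    exact fun h0 => hy ((congrArg (· • δ j) h0).trans (zero_smul ℝ (δ j)))
  have hFf : ∀ a, deltaFunctional H a = f (F a) := hδ
  have hset : deltaSet (X := EuclideanSpace ℝ (Fin n)) H = Set.range f := by
    rw [deltaSet, show deltaFunctional (X := EuclideanSpace ℝ (Fin n)) H = f ∘ F from funext hFf,
      hFs.range_comp]
  refine ⟨H, i1, i2, i3, i4, fun g => ?_, ?_⟩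
  · have : (fun x : EuclideanSpace ℝ (Fin n) => g x) = fun x => f (F x) g := by
      ext x
      rw [← hFf, deltaFunctional_apply]
    rw [this]
    exact ((ContinuousLinearMap.apply 𝕜 𝕜 g).continuous.comp hf.continuous).comp hFc
  -- Pairing with `h j` returns `κ j` at points `F a`, hence on all of `N` by surjectivity; the real
  -- part makes the target `ℝ` when `𝕜 = ℂ`.
  let p : J → StrongDual 𝕜 H →L[ℝ] ℝ := fun j =>
    RCLike.reCLM ∘L (ContinuousLinearMap.apply 𝕜 𝕜 (h j)).restrictScalars ℝ
  have hp : ∀ j y, p j (f y) = κ j y := by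
    intro j y
    obtain ⟨a, rfl⟩ := hFs y
    have := hh a j
    rw [hFf] at this
    simp [p, this]
  let P : (Fin n → J) → StrongDual 𝕜 H →L[ℝ] EuclideanSpace ℝ (Fin n) := fun j =>
    ((EuclideanSpace.equiv (Fin n) ℝ).symm : (Fin n → ℝ) →L[ℝ] EuclideanSpace ℝ (Fin n)) ∘L
      ContinuousLinearMap.pi fun m => p (j m)
  have hP : ∀ j v m, P j v m = p (j m) v := fun j v m => rfl
  rw [hset]
  refine isEmbeddedSubmanifoldDiffeomorphicTo_range hf ?_ fun x => ?_
  · refine Topology.IsInducing.isEmbedding (isInducing_of_locally_recovered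
      (E := EuclideanSpace ℝ (Fin n)) hf.continuous fun x => ?_)
    obtain ⟨φ, -, j₀, j, h1, hs, hφ⟩ := hloc x
    refine ⟨φ, p j₀, P j, (p j₀).continuous, (P j).continuous, ?_, fun y hy => hs y ?_,
      fun y => ?_⟩
    · rw [hp, h1.eq_of_nhds]
      exact one_ne_zero
    · rwa [hp] at hy
    · ext m
      simp [hP, hp, hφ]
  · obtain ⟨φ, hmem, j₀, j, h1, hs, hφ⟩ := hloc x
    refine ⟨φ, hmem, hs x (by rw [h1.eq_of_nhds]; exact one_ne_zero), P j, ?_⟩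
    filter_upwards [h1] with y hy
    ext m
    rw [hP, hp, hφ, hy, Pi.one_apply, one_mul]
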